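/- Let $\widehat M=PGL(2,\mathbb Z)$ be the extended modular group, acting on $\mathbb Q\cup\{\infty\}$ by linear fractional transformations $z\mapsto\frac{az+b}{cz+d}$ with $a,b,c,d\in\mathbb Z$ and $ad-bc=\pm1$, and let $M=PSL(2,\mathbb Z)$ be the subgroup of the transformations of determinant $1$. A subgroup $\widehat S\le\widehat M$ is called a Neumann subgroup if for every $r\in\mathbb Q\cup\{\infty\}$ there is exactly one $\alpha\in\widehat S$ with $\alpha(\infty)=r$. Theorem. Let $\widehat r_2,\widehat r_3,\widehat r_\infty^-\in\{0,1,2,\dots\}\cup\{\infty\}$ and $\widehat r_\infty^+\in\{0,2,4,\dots\}\cup\{\infty\}$ satisfy 1. $\widehat r_2+\widehat r_3+\widehat r_\infty^-+\widehat r_\infty^+=\infty$, 2. $\widehat r_\infty^-\ge 1$, 3. $\widehat r_2+\widehat r_3+\frac{\widehat r_\infty^+}{2}\ge\widehat r_\infty^-$. Then there is a Neumann subgroup $\widehat S$ of $\widehat M$ with $\widehat S\not\subseteq M$ that is the free product of $\widehat r_2$ subgroups of order $2$, $\widehat r_3$ subgroups of order $3$ and $\widehat r_\infty^-+\widehat r_\infty^+$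 infinite cyclic subgroups. Moreover, $\widehat S$ can be chosen so that it is in addition the free product of the cyclic subgroups generated by a system of elements consisting of $\widehat r_2$ elements of order $2$ and $\widehat r_3$ elements of order $3$, all of determinant $1$, together with $\widehat r_\infty^-$ elements of infinite order and determinant $-1$ and $\widehat r_\infty^+$ elements of infinite order and determinant $1$. -/

import Mathlib

open scoped MatrixGroups

universe u

namespace NeumannSubgroup

/-- The action of the extended modular group `PGL(2, ℤ)` on `ℚ ∪ {∞}` by linear fractional
transformations `z ↦ (a z + b) / (c z + d)`. It is induced by Mathlib's action of `GL(2, ℚ)`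
on `OnePoint ℚ`. -/
def moebius : PGL(2, ℤ) →* Equiv.Perm (OnePoint ℚ) :=
  Matrix.ProjGenLinGroup.lift
    ((MulAction.toPermHom (GL (Fin 2) ℚ) (OnePoint ℚ)).comp
      (Matrix.GeneralLinearGroup.map (Int.castRingHom ℚ))) <| by
    ext u z
    rcases Int.units_eq_one_or u with rfl | rfl <;>
      cases z <;>
      simp [OnePoint.smul_infty_eq_ite, OnePoint.smul_some_eq_ite]

/-- `α(∞) = a / c`, with the convention `a / 0 = ∞`. -/
theorem moebius_mk_infty (g : GL (Fin 2) ℤ) :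
    moebius (Matrix.ProjGenLinGroup.mk g) OnePoint.infty =
      if g 1 0 = 0 then OnePoint.infty else (((g 0 0 : ℚ) / (g 1 0 : ℚ) : ℚ) : OnePoint ℚ) := by
  simp [moebius, OnePoint.smul_infty_eq_ite]

/-- The determinant, which is well defined on `PGL(2, ℤ)` because scalars are `±1`. -/
def det : PGL(2, ℤ) →* ℤˣ :=
  Matrix.ProjGenLinGroup.lift Matrix.GeneralLinearGroup.det <| by
    ext u
    rcases Int.units_eq_one_or u with rfl | rfl <;> simp

/-- The modular group `M`: the transformations of determinant `1`. -/
def modularGroup : Subgroup PGL(2, ℤ) := det.ker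

/-- The modular group is the image of `PSL(2, ℤ)` in `PGL(2, ℤ)`. -/
theorem modularGroup_eq_range :
    modularGroup =
      (Matrix.ProjectiveSpecialLinearGroup.toPGL (n := Fin 2) (R := ℤ)).range := by
  ext x
  constructor
  · induction x using Matrix.ProjGenLinGroup.induction_on with
    | mk g =>
      intro h
      have h1 : (g : Matrix (Fin 2) (Fin 2) ℤ).det = 1 := by
        have := congrArg Units.val (show Matrix.GeneralLinearGroup.det g = 1 from h)
        simpa using this
      have h2 : Matrix.SpecialLinearGroup.toGL
          (⟨(g : Matrix (Fin 2) (Fin 2) ℤ), h1⟩ : SL(2, ℤ)) = g := by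
        ext i j
        rfl
      exact ⟨QuotientGroup.mk (⟨(g : Matrix (Fin 2) (Fin 2) ℤ), h1⟩ : SL(2, ℤ)),
        congrArg Matrix.ProjGenLinGroup.mk h2⟩
  · rintro ⟨y, rfl⟩
    induction y using QuotientGroup.induction_on with
    | H g =>
      change Matrix.GeneralLinearGroup.det (Matrix.SpecialLinearGroup.toGL g) = 1
      ext
      simp

/-- A subgroup of `PGL(2, ℤ)` is a Neumann subgroup if every `r ∈ ℚ ∪ {∞}` is `α(∞)` for
exactly one element `α` of the subgroup. -/
def IsNeumann (S : Subgroup PGL(2, ℤ)) : Prop :=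
  ∀ r : OnePoint ℚ, ∃! α : PGL(2, ℤ), α ∈ S ∧ moebius α OnePoint.infty = r

/-- `G` is the (internal) free product of the family `H` of its subgroups: the homomorphism
from the abstract free product of the `H i` that extends all inclusions is bijective. -/
def IsFreeProductOf {G : Type u} [Group G] {ι : Type u} (H : ι → Subgroup G) : Prop :=
  Function.Bijective (Monoid.CoprodI.lift fun i => (H i).subtype)

/-- `G` has `(r₂, r₃, r)`-structure: it is a free product of `r₂` subgroups of order `2`,
`r₃` subgroups of order `3` and `r` infinite cyclic subgroups. -/
def HasStructure (G : Type u) [Group G] (r₂ r₃ r : ℕ∞) : Prop :=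
  ∃ (I₂ I₃ I : Type u) (A : I₂ → Subgroup G) (B : I₃ → Subgroup G) (C : I → Subgroup G),
    ENat.card I₂ = r₂ ∧ ENat.card I₃ = r₃ ∧ ENat.card I = r ∧
    (∀ i, Nat.card (A i) = 2) ∧
    (∀ i, Nat.card (B i) = 3) ∧
    (∀ i, IsCyclic (C i) ∧ Infinite (C i)) ∧
    IsFreeProductOf (Sum.elim A (Sum.elim B C))

/-- `S` has a system of independent generators (`S` is the free product of the cyclic subgroups
they generate) that consists of `r₂` elements of order `2` and `r₃` elements of order `3`, all of
determinant `1`, together with `rm` elements of infinite order and determinant `-1` and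
`rp` elements of infinite order and determinant `1`. -/
def HasIndependentGenerators (S : Subgroup PGL(2, ℤ)) (r₂ r₃ rm rp : ℕ∞) : Prop :=
  ∃ (I₂ I₃ Im Ip : Type) (a : I₂ → S) (b : I₃ → S) (c : Im → S) (d : Ip → S),
    ENat.card I₂ = r₂ ∧ ENat.card I₃ = r₃ ∧ ENat.card Im = rm ∧ ENat.card Ip = rp ∧
    (∀ i, orderOf (a i) = 2 ∧ det (a i) = 1) ∧
    (∀ i, orderOf (b i) = 3 ∧ det (b i) = 1) ∧
    (∀ i, ¬ IsOfFinOrder (c i) ∧ det (c i) = -1) ∧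
    (∀ i, ¬ IsOfFinOrder (d i) ∧ det (d i) = 1) ∧
    IsFreeProductOf fun i =>
      Subgroup.zpowers (Sum.elim a (Sum.elim b (Sum.elim c d)) i)

end NeumannSubgroup

/-!
A subgroup `S` of `PGL(2, ℤ)` is a Neumann subgroup as soon as two things hold. For every integer
`n` it contains a transformation mapping `∞` to `n`: such a transformation has the form
`edgePairing n q ε : z ↦ n - ε / (z - q)`, its inverse lowers the denominator of non-integers with
floor `n`, so by Euclid's algorithm `S` is transitive on `ℚ ∪ {∞}` (`exists_moebius_infty_eq`).
And no nontrivial element of `S` fixes `∞`. The second property and the free product structure come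
together from a ping-pong argument (`lift_smul_ne_of_ping_pong`): if the nontrivial elements of the
cyclic factors map the complements of pairwise disjoint domains in `ℚ` into these domains, then a
nontrivial reduced word maps `∞` into one of the domains.

It remains to choose generators. The quotient of the Farey tree by `S` is to be an infinite ray
with a small ribbon graph, called a gadget below, attached at each vertex: a half-edge for a
generator of order `2`, a vertex of degree `1` for a generator of order `3`, a twisted loop
(crosscap) for one generator of determinant `-1`, and a one-holed torus (handle) for two generators
of determinant `1`. Walking around this graph labels its edge sides by the integers. Gadget `k`
occupies the integers strictly between `cut e k` and `cut e (k + 1)`, with generators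

* `edgePairing (c + 1) (c + 1) 1` for order `2`,
* `edgePairing (c + 2) (c + 1) 1` for order `3`,
* `edgePairing (c + 3) (c + 2) (-1)` for a crosscap,
* `edgePairing (c + 7) (c + 3) 1` and `edgePairing (c + 8) (c + 4) 1` for a handle,

where `c = cut e k`, and their domains lie in the interval from `cut e k` to `cut e (k + 1)`. At
the end of the ray sits one further twisted loop `edgePairing 1 0 (-1)`, with domain `(-∞, 2]`,
which exists because at least one generator of determinant `-1` is wanted. The remaining integers
are the sides of the edges of the ray: the product of the boundary words of the loop at the end and
the first `k` gadgets is `edgePairing (cut e k) (-1 - k) 1` (`edgePairing_cut_mem`). Hence all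
integers are reached from `∞` because there are infinitely many gadgets.
-/

namespace NeumannSubgroup

/-! ### The transformations that pair two edges at infinity -/

/-- The matrix `!![p, -p q - ε; 1, -q]`, of determinant `ε`. -/
noncomputable def edgePairingMatrix (p q : ℤ) (ε : ℤˣ) : GL (Fin 2) ℤ :=
  Matrix.GeneralLinearGroup.mk'' !![p, -p * q - ε; 1, -q] <| by
    have h : p * -q - (-p * q - ε) * 1 = ε := by ring
    rw [Matrix.det_fin_two_of, h]
    exact ε.isUnit

theorem coe_edgePairingMatrix (p q : ℤ) (ε : ℤˣ) :
    (edgePairingMatrix p q ε : Matrix (Fin 2) (Fin 2) ℤ) = !![p, -p * q - ε; 1, -q] :=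
  rfl

/-- The transformation `z ↦ p - ε / (z - q)` of determinant `ε`. These are exactly the elements
of `PGL(2, ℤ)` that map `∞` to `p` and `q` to `∞`, so they carry the Farey edge `(q, ∞)` to the
Farey edge `(∞, p)`. -/
noncomputable def edgePairing (p q : ℤ) (ε : ℤˣ) : PGL(2, ℤ) :=
  Matrix.ProjGenLinGroup.mk (edgePairingMatrix p q ε)

@[simp]
theorem det_edgePairing (p q : ℤ) (ε : ℤˣ) : det (edgePairing p q ε) = ε := by
  change Matrix.GeneralLinearGroup.det (edgePairingMatrix p q ε) = ε
  ext
  rw [Matrix.GeneralLinearGroup.val_det_apply, coe_edgePairingMatrix, Matrix.det_fin_two_of]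
  ring

@[simp]
theorem moebius_edgePairing_infty (p q : ℤ) (ε : ℤˣ) :
    moebius (edgePairing p q ε) OnePoint.infty = ((p : ℚ) : OnePoint ℚ) := by
  rw [edgePairing, moebius_mk_infty]
  simp [coe_edgePairingMatrix]

theorem moebius_edgePairing_coe (p q : ℤ) (ε : ℤˣ) {z : ℚ} (hz : z ≠ q) :
    moebius (edgePairing p q ε) z = ((p - (ε : ℤ) / (z - q) : ℚ) : OnePoint ℚ) := by
  have h : z - q ≠ 0 := sub_ne_zero.2 hz
  have h' : z + -q ≠ 0 := by rwa [← sub_eq_add_neg]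
  simp [edgePairing, coe_edgePairingMatrix, moebius, OnePoint.smul_some_eq_ite, h']
  field_simp
  ring

theorem mk_eq_mk_of_coe {g h : GL (Fin 2) ℤ}
    (H : (g : Matrix (Fin 2) (Fin 2) ℤ) = h ∨ (g : Matrix (Fin 2) (Fin 2) ℤ) = -h) :
    Matrix.ProjGenLinGroup.mk g = Matrix.ProjGenLinGroup.mk h := by
  rcases H with H | H
  · rw [Units.ext H]
  · refine (Matrix.ProjGenLinGroup.mk_eq_mk_iff.2 ⟨-1, ?_⟩).symm
    ext i j
    fin_cases j <;> simp [H, Matrix.mul_apply]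

theorem edgePairing_mul_swap (p q : ℤ) (ε : ℤˣ) : edgePairing p q ε * edgePairing q p ε = 1 := by
  rw [edgePairing, edgePairing, ← map_mul, ← map_one Matrix.ProjGenLinGroup.mk]
  apply mk_eq_mk_of_coe
  rw [Units.val_mul, coe_edgePairingMatrix, coe_edgePairingMatrix, Matrix.mul_fin_two]
  rcases Int.units_eq_one_or ε with rfl | rfl
  · right
    ext i j
    fin_cases i <;> fin_cases j <;> simp <;> ring
  · left
    ext i j
    fin_cases i <;> fin_cases j <;> simp <;> ring

theorem edgePairing_inv (p q : ℤ) (ε : ℤˣ) : (edgePairing p q ε)⁻¹ = edgePairing q p ε :=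
  inv_eq_of_mul_eq_one_right (edgePairing_mul_swap p q ε)

/-- The relation around a vertex of the tree dual to the Farey tessellation. -/
theorem edgePairing_mul_edgePairing (p q s : ℤ) :
    edgePairing p q 1 * edgePairing (q - 1) s 1 = edgePairing (p + 1) (s - 1) 1 := by
  rw [edgePairing, edgePairing, ← map_mul]
  apply mk_eq_mk_of_coe
  rw [Units.val_mul, coe_edgePairingMatrix, coe_edgePairingMatrix, Matrix.mul_fin_two,
    coe_edgePairingMatrix]
  right
  ext i j
  fin_cases i <;> fin_cases j <;> simp <;> ring

/-- The vertex relation at a vertex that carries an orientation-reversing loop. -/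
theorem edgePairing_neg_one_mul_self (p : ℤ) :
    edgePairing p (p - 1) (-1) * edgePairing p (p - 1) (-1) = edgePairing (p + 1) (p - 2) 1 := by
  rw [edgePairing, ← map_mul]
  apply mk_eq_mk_of_coe
  rw [Units.val_mul, coe_edgePairingMatrix, Matrix.mul_fin_two, coe_edgePairingMatrix]
  left
  ext i j
  fin_cases i <;> fin_cases j <;> simp <;> ring

/-- The vertex relation at a vertex of degree `1`. -/
theorem edgePairing_succ_mul_self (p : ℤ) :
    edgePairing (p + 1) p 1 * edgePairing (p + 1) p 1 = edgePairing p (p + 1) 1 := by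
  rw [edgePairing, ← map_mul]
  apply mk_eq_mk_of_coe
  rw [Units.val_mul, coe_edgePairingMatrix, Matrix.mul_fin_two, coe_edgePairingMatrix]
  left
  ext i j
  fin_cases i <;> fin_cases j <;> simp <;> ring

theorem edgePairing_ne_one (p q : ℤ) (ε : ℤˣ) : edgePairing p q ε ≠ 1 := by
  intro h
  have := moebius_edgePairing_infty p q ε
  rw [h] at this
  simp at this

theorem orderOf_edgePairing_self (p : ℤ) : orderOf (edgePairing p p 1) = 2 :=
  orderOf_eq_prime (by rw [pow_two, edgePairing_mul_swap]) (edgePairing_ne_one _ _ _)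

theorem orderOf_edgePairing_succ (p : ℤ) : orderOf (edgePairing (p + 1) p 1) = 3 :=
  orderOf_eq_prime
    (by rw [pow_succ, pow_two, edgePairing_succ_mul_self, edgePairing_mul_swap])
    (edgePairing_ne_one _ _ _)

/-! ### Transitivity from the integers -/

/-- Euclid's algorithm: if a subgroup contains, for every integer `n`, a transformation that maps
`∞` to `n`, then it acts transitively on `ℚ ∪ {∞}`. -/
theorem exists_moebius_infty_eq {S : Subgroup PGL(2, ℤ)}
    (hS : ∀ n : ℤ, ∃ q ε, edgePairing n q ε ∈ S) (r : OnePoint ℚ) :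
    ∃ g ∈ S, moebius g OnePoint.infty = r := by
  induction r using OnePoint.rec with
  | infty => exact ⟨1, S.one_mem, by simp⟩
  | coe r =>
    induction hd : r.den using Nat.strong_induction_on generalizing r with
    | _ d ih =>
    obtain ⟨q, ε, hg⟩ := hS ⌊r⌋
    by_cases hr : r = ⌊r⌋
    · exact ⟨_, hg, by rw [moebius_edgePairing_infty, ← hr]⟩
    -- The inverse of the transformation reaching `⌊r⌋` sends `r` to a fraction whose
    -- denominator divides the numerator `m` of the fractional part of `r`.
    obtain ⟨m, hm⟩ : ∃ m : ℤ, m = r.num - ⌊r⌋ * r.den := ⟨_, rfl⟩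
    have hden : (0 : ℚ) < r.den := by exact_mod_cast r.den_pos
    have hfract : r - ⌊r⌋ = m / r.den := by
      rw [hm, eq_div_iff hden.ne', sub_mul, Rat.mul_den_eq_num]
      push_cast
      ring
    have hm_pos : 0 < m := by
      have h : (0 : ℚ) < m / r.den := by
        rw [← hfract, sub_pos]
        exact lt_of_le_of_ne (Int.floor_le r) (Ne.symm hr)
      exact_mod_cast (div_pos_iff_of_pos_right hden).1 h
    have hm_lt : m < r.den := by
      have h : (m : ℚ) / r.den < 1 := by
        rw [← hfract]
        linarith [Int.lt_floor_add_one r]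
      exact_mod_cast (div_lt_one hden).1 h
    have hlt : (q - (ε : ℤ) / (r - ⌊r⌋) : ℚ).den < d := by
      have hm0 : (m : ℚ) ≠ 0 := by exact_mod_cast hm_pos.ne'
      have h : (q - (ε : ℤ) / (r - ⌊r⌋) : ℚ) =
          ((q * m - ε * r.den : ℤ) : ℚ) / ((m : ℤ) : ℚ) := by
        rw [hfract]
        push_cast
        field_simp
      have hdvd := Int.le_of_dvd hm_pos (Rat.den_dvd (q * m - ε * r.den) m)
      rw [Rat.divInt_eq_div] at hdvd
      rw [h]
      omega
    obtain ⟨h, hhS, hh⟩ := ih _ hlt _ rfl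
    refine ⟨edgePairing ⌊r⌋ q ε * h, S.mul_mem hg hhS, ?_⟩
    rw [map_mul, Equiv.Perm.mul_apply, hh, ← moebius_edgePairing_coe q ⌊r⌋ ε hr,
      ← Equiv.Perm.mul_apply, ← map_mul, edgePairing_mul_swap]
    simp

/-! ### Ping-pong for free products of cyclic groups -/

/-- A ping-pong criterion relative to a base point `x₀` outside all the domains `D i`. Unlike
`Monoid.CoprodI.lift_injective_of_ping_pong` it shows that nontrivial elements of the free product
move `x₀`. -/
theorem lift_smul_ne_of_ping_pong {ι : Type*} {H : ι → Type*} [∀ i, Group (H i)]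
    {X : Type*} (f : ∀ i, H i →* Equiv.Perm X) (D : ι → Set X)
    (hdisj : ∀ i j, i ≠ j → Disjoint (D i) (D j))
    (hmap : ∀ i, ∀ h : H i, h ≠ 1 → ∀ x ∉ D i, f i h x ∈ D i)
    {x₀ : X} (hx₀ : ∀ i, x₀ ∉ D i) {w : Monoid.CoprodI H} (hw : w ≠ 1) :
    Monoid.CoprodI.lift f w x₀ ≠ x₀ := by
  classical
  have key : ∀ {i j} (v : Monoid.CoprodI.NeWord H i j), ∀ x ∉ D j,
      Monoid.CoprodI.lift f v.prod x ∈ D i := by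
    intro i j v
    induction v with
    | singleton h hh => simpa using hmap _ h hh
    | @append i j k l v₁ hne v₂ h₁ h₂ =>
      intro x hx
      simp only [Monoid.CoprodI.NeWord.append_prod, map_mul, Equiv.Perm.mul_apply]
      exact h₁ _ ((hdisj _ _ hne).notMem_of_mem_right (h₂ x hx))
  have hne : Monoid.CoprodI.Word.equiv w ≠ Monoid.CoprodI.Word.empty := by
    intro h
    exact hw (by rw [← Monoid.CoprodI.Word.equiv.symm_apply_apply w, h]; rfl)
  obtain ⟨i, j, v, hv⟩ := Monoid.CoprodI.NeWord.of_word _ hne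
  have hprod : v.prod = w := by
    rw [Monoid.CoprodI.NeWord.prod, hv]
    exact Monoid.CoprodI.Word.equiv.symm_apply_apply w
  intro h
  have := key v x₀ (hx₀ j)
  rw [hprod, h] at this
  exact hx₀ i this

/-- If `g` maps the complement of `A` into `B`, with `A` and `B` disjoint, then every nontrivial
power of `g` maps the complement of `A ∪ B` into `A ∪ B`. -/
theorem zpow_apply_mem_union {X : Type*} {g : Equiv.Perm X} {A B : Set X} (hAB : Disjoint A B)
    (hg : ∀ x ∉ A, g x ∈ B) {k : ℤ} (hk : k ≠ 0) {x : X} (hx : x ∉ A ∪ B) :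
    (g ^ k) x ∈ A ∪ B := by
  have hA : x ∉ A := fun h => hx (Or.inl h)
  have hB : x ∉ B := fun h => hx (Or.inr h)
  have hg' : ∀ y ∉ B, g⁻¹ y ∈ A := by
    intro y hy
    by_contra h
    exact hy (by simpa using hg _ h)
  have hpos : ∀ n : ℕ, (g ^ (n + 1)) x ∈ B := by
    intro n
    induction n with
    | zero => simpa using hg x hA
    | succ n ih =>
      rw [pow_succ', Equiv.Perm.mul_apply]
      exact hg _ (hAB.notMem_of_mem_right ih)
  have hneg : ∀ n : ℕ, (g⁻¹ ^ (n + 1)) x ∈ A := by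
    intro n
    induction n with
    | zero => simpa using hg' x hB
    | succ n ih =>
      rw [pow_succ', Equiv.Perm.mul_apply]
      exact hg' _ (hAB.notMem_of_mem_left ih)
  obtain ⟨n, rfl | rfl⟩ := k.eq_nat_or_neg
  · obtain ⟨m, rfl⟩ := Nat.exists_eq_succ_of_ne_zero (show n ≠ 0 by simpa using hk)
    exact Or.inr (by rw [zpow_natCast]; exact hpos m)
  · obtain ⟨m, rfl⟩ := Nat.exists_eq_succ_of_ne_zero (show n ≠ 0 by simpa using hk)
    exact Or.inl (by rw [zpow_neg, zpow_natCast, ← inv_pow]; exact hneg m)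

/-! ### Powers of edge pairings on their domains -/

theorem moebius_edgePairing_mem {A B : Set ℚ} {p q : ℤ} {ε : ℤˣ} (hq : (q : ℚ) ∈ A)
    (hp : (p : ℚ) ∈ B) (h : ∀ y : ℚ, q + y ∉ A → p - (ε : ℤ) * y⁻¹ ∈ B) :
    ∀ x ∉ ((↑) '' A : Set (OnePoint ℚ)),
      moebius (edgePairing p q ε) x ∈ ((↑) '' B : Set (OnePoint ℚ)) := by
  intro x hx
  induction x using OnePoint.rec with
  | infty => exact ⟨p, hp, (moebius_edgePairing_infty p q ε).symm⟩
  | coe z =>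
    have hz : z ∉ A := fun hz => hx ⟨z, hz, rfl⟩
    have hne : z ≠ q := fun hzq => hz (hzq ▸ hq)
    refine ⟨_, h (z - q) (by simpa using hz), ?_⟩
    rw [moebius_edgePairing_coe p q ε hne, div_eq_mul_inv]

/-- The ping-pong condition for an element `g` of `PGL(2, ℤ)`: every nontrivial power of `g` maps
the complement of `D` in `ℚ ∪ {∞}` into `D`. -/
def PlaysOn (g : PGL(2, ℤ)) (D : Set ℚ) : Prop :=
  ∀ k : ℤ, g ^ k ≠ 1 → ∀ x ∉ ((↑) '' D : Set (OnePoint ℚ)),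
    moebius (g ^ k) x ∈ ((↑) '' D : Set (OnePoint ℚ))

theorem infty_notMem_image_coe (D : Set ℚ) :
    OnePoint.infty ∉ ((↑) '' D : Set (OnePoint ℚ)) := by
  simp

theorem zpow_edgePairing_mem {A B : Set ℚ} (hAB : Disjoint A B) {p q : ℤ} {ε : ℤˣ}
    (hq : (q : ℚ) ∈ A) (hp : (p : ℚ) ∈ B)
    (h : ∀ y : ℚ, q + y ∉ A → p - (ε : ℤ) * y⁻¹ ∈ B) {k : ℤ} (hk : k ≠ 0) :
    ∀ x ∉ ((↑) '' (A ∪ B) : Set (OnePoint ℚ)),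
      moebius (edgePairing p q ε ^ k) x ∈ ((↑) '' (A ∪ B) : Set (OnePoint ℚ)) := by
  intro x hx
  rw [Set.image_union] at hx ⊢
  rw [map_zpow]
  exact zpow_apply_mem_union (Set.disjoint_image_of_injective OnePoint.coe_injective hAB)
    (moebius_edgePairing_mem hq hp h) hk hx

theorem playsOn_edgePairing {A B : Set ℚ} (hAB : Disjoint A B) {p q : ℤ} {ε : ℤˣ}
    (hq : (q : ℚ) ∈ A) (hp : (p : ℚ) ∈ B)
    (h : ∀ y : ℚ, q + y ∉ A → p - (ε : ℤ) * y⁻¹ ∈ B) :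
    PlaysOn (edgePairing p q ε) (A ∪ B) ∧ ¬ IsOfFinOrder (edgePairing p q ε) := by
  constructor
  · intro k hk
    exact zpow_edgePairing_mem hAB hq hp h (by rintro rfl; simp at hk)
  · rw [isOfFinOrder_iff_zpow_eq_one]
    rintro ⟨k, hk, hk1⟩
    have := zpow_edgePairing_mem hAB hq hp h hk _ (infty_notMem_image_coe _)
    rw [hk1] at this
    simp at this

theorem inv_bounds_of_lt {a y : ℚ} (ha : 0 < a) (hy : a < y) : 0 < y⁻¹ ∧ y⁻¹ < a⁻¹ :=
  ⟨inv_pos.2 (ha.trans hy), (inv_lt_inv₀ (ha.trans hy) ha).2 hy⟩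

theorem inv_bounds_of_le {a y : ℚ} (ha : 0 < a) (hy : a ≤ y) : 0 < y⁻¹ ∧ y⁻¹ ≤ a⁻¹ :=
  ⟨inv_pos.2 (ha.trans_le hy), (inv_le_inv₀ (ha.trans_le hy) ha).2 hy⟩

theorem inv_bounds_of_le_neg {a y : ℚ} (ha : 0 < a) (hy : y ≤ -a) : y⁻¹ < 0 ∧ -a⁻¹ ≤ y⁻¹ := by
  obtain ⟨h₁, h₂⟩ := inv_bounds_of_le ha (le_neg_of_le_neg hy)
  rw [inv_neg] at h₁ h₂
  constructor <;> linarith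

theorem playsOn_orderTwo (c : ℤ) :
    PlaysOn (edgePairing (c + 1) (c + 1) 1) (Set.Ioc c (c + 2)) := by
  intro k hk
  have hsq : edgePairing (c + 1) (c + 1) 1 ^ (2 : ℤ) = 1 := by
    rw [zpow_two, edgePairing_mul_swap]
  obtain ⟨m, rfl | rfl⟩ := Int.even_or_odd' k
  · rw [zpow_mul, hsq, one_zpow] at hk
    exact absurd rfl hk
  · rw [zpow_add, zpow_mul, hsq, one_zpow, one_mul, zpow_one]
    refine moebius_edgePairing_mem ?_ ?_ fun y hy => ?_
    · simp
    · simp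
    · simp only [Set.mem_Ioc, not_and_or, not_lt, not_le] at hy ⊢
      push_cast at hy ⊢
      rcases hy with hy | hy
      · have := inv_bounds_of_le_neg (y := y) one_pos (by linarith)
        constructor <;> linarith
      · have := inv_bounds_of_lt (y := y) one_pos (by linarith)
        constructor <;> linarith

theorem playsOn_orderThree (c : ℤ) :
    PlaysOn (edgePairing (c + 2) (c + 1) 1) (Set.Ioc c (c + 3)) := by
  intro k hk
  have hsq : edgePairing (c + 2) (c + 1) 1 * edgePairing (c + 2) (c + 1) 1 =
      edgePairing (c + 1) (c + 2) 1 := by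
    have := edgePairing_succ_mul_self (c + 1)
    rwa [show c + 1 + 1 = c + 2 by ring] at this
  have hcube : edgePairing (c + 2) (c + 1) 1 ^ (3 : ℤ) = 1 := by
    rw [show (3 : ℤ) = 2 + 1 by norm_num, zpow_add_one, zpow_two, hsq, edgePairing_mul_swap]
  obtain ⟨m, rfl | rfl | rfl⟩ : ∃ m, k = 3 * m ∨ k = 3 * m + 1 ∨ k = 3 * m + 2 :=
    ⟨k / 3, by omega⟩
  · rw [zpow_mul, hcube, one_zpow] at hk
    exact absurd rfl hk
  · rw [zpow_add, zpow_mul, hcube, one_zpow, one_mul, zpow_one]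
    refine moebius_edgePairing_mem ?_ ?_ fun y hy => ?_
    · simp
    · simp; norm_num
    · simp only [Set.mem_Ioc, not_and_or, not_lt, not_le] at hy ⊢
      push_cast at hy ⊢
      rcases hy with hy | hy
      · have := inv_bounds_of_le_neg (y := y) one_pos (by linarith)
        constructor <;> linarith
      · have := inv_bounds_of_lt (y := y) two_pos (by linarith)
        constructor <;> linarith
  · rw [zpow_add, zpow_mul, hcube, one_zpow, one_mul, zpow_two, hsq]
    refine moebius_edgePairing_mem ?_ ?_ fun y hy => ?_
    · simp; norm_num
    · simp
    · simp only [Set.mem_Ioc, not_and_or, not_lt, not_le] at hy ⊢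
      push_cast at hy ⊢
      rcases hy with hy | hy
      · have := inv_bounds_of_le_neg (y := y) two_pos (by linarith)
        constructor <;> linarith
      · have := inv_bounds_of_lt (y := y) one_pos (by linarith)
        constructor <;> linarith

theorem playsOn_edgePairing_one_zero :
    PlaysOn (edgePairing 1 0 (-1)) (Set.Iio 1 ∪ Set.Icc 1 2) ∧
      ¬ IsOfFinOrder (edgePairing 1 0 (-1)) := by
  refine playsOn_edgePairing ?_ ?_ ?_ fun y hy => ?_
  · rw [Set.disjoint_left]
    intro z hA hB
    exact absurd hA (not_lt.2 hB.1)
  · simp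
  · simp
  · simp only [Set.mem_Iio, Set.mem_Icc, not_lt] at hy ⊢
    push_cast at hy ⊢
    have := inv_bounds_of_le (y := y) one_pos (by linarith)
    constructor <;> linarith

theorem playsOn_crosscap (c : ℤ) :
    PlaysOn (edgePairing (c + 3) (c + 2) (-1))
        (Set.Ioo c (c + 5 / 2) ∪ Set.Icc (c + 5 / 2) (c + 5)) ∧
      ¬ IsOfFinOrder (edgePairing (c + 3) (c + 2) (-1)) := by
  refine playsOn_edgePairing ?_ ?_ ?_ fun y hy => ?_
  · rw [Set.disjoint_left]
    intro z hA hB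
    exact absurd hA.2 (not_lt.2 hB.1)
  · simp; norm_num
  · simp; norm_num
  · simp only [Set.mem_Ioo, Set.mem_Icc, not_and_or, not_lt] at hy ⊢
    push_cast at hy ⊢
    rcases hy with hy | hy
    · have := inv_bounds_of_le_neg (y := y) two_pos (by linarith)
      constructor <;> linarith
    · have := inv_bounds_of_le (a := 1 / 2) (y := y) (by norm_num) (by linarith)
      constructor <;> linarith

theorem playsOn_handle_left (c : ℤ) :
    PlaysOn (edgePairing (c + 7) (c + 3) 1)
        (Set.Ioc c (c + 11 / 3) ∪ Set.Ioc (c + 11 / 2) (c + 22 / 3)) ∧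
      ¬ IsOfFinOrder (edgePairing (c + 7) (c + 3) 1) := by
  refine playsOn_edgePairing ?_ ?_ ?_ fun y hy => ?_
  · rw [Set.disjoint_left]
    intro z hA hB
    linarith [hA.2, hB.1]
  · simp; norm_num
  · simp; norm_num
  · simp only [Set.mem_Ioc, not_and_or, not_lt, not_le] at hy ⊢
    push_cast at hy ⊢
    rcases hy with hy | hy
    · have := inv_bounds_of_le_neg (y := y) three_pos (by linarith)
      constructor <;> linarith
    · have := inv_bounds_of_lt (a := 2 / 3) (y := y) (by norm_num) (by linarith)
      constructor <;> linarith

theorem playsOn_handle_right (c : ℤ) :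
    PlaysOn (edgePairing (c + 8) (c + 4) 1)
        (Set.Ioc (c + 11 / 3) (c + 11 / 2) ∪ Set.Ioc (c + 22 / 3) (c + 11)) ∧
      ¬ IsOfFinOrder (edgePairing (c + 8) (c + 4) 1) := by
  refine playsOn_edgePairing ?_ ?_ ?_ fun y hy => ?_
  · rw [Set.disjoint_left]
    intro z hA hB
    linarith [hA.2, hB.1]
  · simp; norm_num
  · simp; norm_num
  · simp only [Set.mem_Ioc, not_and_or, not_lt, not_le] at hy ⊢
    push_cast at hy ⊢
    rcases hy with hy | hy
    · have := inv_bounds_of_le_neg (a := 1 / 3) (y := y) (by norm_num) (by linarith)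
      constructor <;> linarith
    · have := inv_bounds_of_lt (a := 3 / 2) (y := y) (by norm_num) (by linarith)
      constructor <;> linarith

/-! ### The generators and their domains -/

section Layout

variable {I₂ I₃ Im Ih : Type}

/-- The length of the interval occupied by a gadget: a single element of order `2`,
a single element of order `3`, a crosscap or a handle. -/
def width : I₂ ⊕ I₃ ⊕ Im ⊕ Ih → ℕ
  | .inl _ => 2
  | .inr (.inl _) => 3
  | .inr (.inr (.inl _)) => 5
  | .inr (.inr (.inr _)) => 11

variable (e : I₂ ⊕ I₃ ⊕ Im ⊕ Ih ≃ ℕ)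

/-- The gadget with number `k` in the enumeration `e` occupies the interval from `cut e k`
to `cut e (k + 1)`. -/
def cut : ℕ → ℤ
  | 0 => 2
  | k + 1 => cut k + width (e.symm k)

theorem cut_succ (j : I₂ ⊕ I₃ ⊕ Im ⊕ Ih) : cut e (e j + 1) = cut e (e j) + width j := by
  rw [cut, e.symm_apply_apply]

theorem cut_lt_cut_succ (k : ℕ) : cut e k < cut e (k + 1) := by
  obtain ⟨j, rfl⟩ := e.surjective k
  rw [cut_succ]
  rcases j with i | i | i | i <;> simp [width]

theorem monotone_cut : Monotone (cut e) :=
  monotone_nat_of_le_succ fun k => (cut_lt_cut_succ e k).le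

theorem two_le_cut (k : ℕ) : 2 ≤ cut e k := monotone_cut e (Nat.zero_le k)

/-- The independent generators: one for each gadget of order `2`, order `3` or crosscap, two
for each handle, and one more orientation-reversing generator, indexed by `none`, for the
interval `(-∞, 2]` to the left of all gadgets. -/
noncomputable def gen : I₂ ⊕ I₃ ⊕ Option Im ⊕ Ih ⊕ Ih → PGL(2, ℤ)
  | .inl i => edgePairing (cut e (e (.inl i)) + 1) (cut e (e (.inl i)) + 1) 1
  | .inr (.inl i) => edgePairing (cut e (e (.inr (.inl i))) + 2) (cut e (e (.inr (.inl i))) + 1) 1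
  | .inr (.inr (.inl none)) => edgePairing 1 0 (-1)
  | .inr (.inr (.inl (some i))) =>
    edgePairing (cut e (e (.inr (.inr (.inl i)))) + 3) (cut e (e (.inr (.inr (.inl i)))) + 2) (-1)
  | .inr (.inr (.inr (.inl i))) =>
    edgePairing (cut e (e (.inr (.inr (.inr i)))) + 7) (cut e (e (.inr (.inr (.inr i)))) + 3) 1
  | .inr (.inr (.inr (.inr i))) =>
    edgePairing (cut e (e (.inr (.inr (.inr i)))) + 8) (cut e (e (.inr (.inr (.inr i)))) + 4) 1

/-- The ping-pong domain of each generator. The endpoints are distributed so that the domains are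
disjoint although neighbouring ones touch. -/
def domain : I₂ ⊕ I₃ ⊕ Option Im ⊕ Ih ⊕ Ih → Set ℚ
  | .inl i => Set.Ioc (cut e (e (.inl i))) (cut e (e (.inl i)) + 2)
  | .inr (.inl i) => Set.Ioc (cut e (e (.inr (.inl i)))) (cut e (e (.inr (.inl i))) + 3)
  | .inr (.inr (.inl none)) => Set.Iio 1 ∪ Set.Icc 1 2
  | .inr (.inr (.inl (some i))) =>
    Set.Ioo (cut e (e (.inr (.inr (.inl i)))) : ℚ) (cut e (e (.inr (.inr (.inl i)))) + 5 / 2) ∪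
      Set.Icc (cut e (e (.inr (.inr (.inl i)))) + 5 / 2 : ℚ) (cut e (e (.inr (.inr (.inl i)))) + 5)
  | .inr (.inr (.inr (.inl i))) =>
    Set.Ioc (cut e (e (.inr (.inr (.inr i)))) : ℚ) (cut e (e (.inr (.inr (.inr i)))) + 11 / 3) ∪
      Set.Ioc (cut e (e (.inr (.inr (.inr i)))) + 11 / 2 : ℚ)
        (cut e (e (.inr (.inr (.inr i)))) + 22 / 3)
  | .inr (.inr (.inr (.inr i))) =>
    Set.Ioc (cut e (e (.inr (.inr (.inr i)))) + 11 / 3 : ℚ)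
        (cut e (e (.inr (.inr (.inr i)))) + 11 / 2) ∪
      Set.Ioc (cut e (e (.inr (.inr (.inr i)))) + 22 / 3 : ℚ)
        (cut e (e (.inr (.inr (.inr i)))) + 11)

theorem playsOn_gen (i : I₂ ⊕ I₃ ⊕ Option Im ⊕ Ih ⊕ Ih) : PlaysOn (gen e i) (domain e i) := by
  rcases i with i | i | (_ | i) | i | i
  · exact playsOn_orderTwo _
  · exact playsOn_orderThree _
  · exact playsOn_edgePairing_one_zero.1
  · exact (playsOn_crosscap _).1
  · exact (playsOn_handle_left _).1
  · exact (playsOn_handle_right _).1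

/-- The gadget to which a generator belongs, `none` for the additional generator. -/
def gadget : I₂ ⊕ I₃ ⊕ Option Im ⊕ Ih ⊕ Ih → Option (I₂ ⊕ I₃ ⊕ Im ⊕ Ih)
  | .inl i => some (.inl i)
  | .inr (.inl i) => some (.inr (.inl i))
  | .inr (.inr (.inl none)) => none
  | .inr (.inr (.inl (some i))) => some (.inr (.inr (.inl i)))
  | .inr (.inr (.inr (.inl i))) => some (.inr (.inr (.inr i)))
  | .inr (.inr (.inr (.inr i))) => some (.inr (.inr (.inr i)))

/-- The interval of a gadget, and `(-∞, 2]` for `none`. -/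
def block : Option (I₂ ⊕ I₃ ⊕ Im ⊕ Ih) → Set ℚ
  | none => Set.Iic 2
  | some j => Set.Ioc (cut e (e j)) (cut e (e j + 1))

theorem domain_subset_block (i : I₂ ⊕ I₃ ⊕ Option Im ⊕ Ih ⊕ Ih) :
    domain e i ⊆ block e (gadget i) := by
  rcases i with i | i | (_ | i) | i | i <;> intro z hz <;>
    simp only [domain, gadget, block, cut_succ, width, Set.mem_union, Set.mem_Ioc, Set.mem_Ioo,
      Set.mem_Icc, Set.mem_Iio, Set.mem_Iic] at hz ⊢ <;> push_cast
  · exact hz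
  · exact hz
  · rcases hz with hz | hz <;> linarith
  all_goals rcases hz with hz | hz <;> constructor <;> linarith

theorem disjoint_block {j j' : Option (I₂ ⊕ I₃ ⊕ Im ⊕ Ih)} (h : j ≠ j') :
    Disjoint (block e j) (block e j') := by
  have key : ∀ k k' : ℕ, k < k' →
      Disjoint (Set.Ioc (cut e k : ℚ) (cut e (k + 1))) (Set.Ioc (cut e k') (cut e (k' + 1))) := by
    intro k k' hk
    rw [Set.disjoint_left]
    intro z hz hz'
    have : (cut e (k + 1) : ℚ) ≤ cut e k' := by exact_mod_cast monotone_cut e hk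
    linarith [hz.2, hz'.1]
  have key' : ∀ k : ℕ, Disjoint (Set.Iic (2 : ℚ)) (Set.Ioc (cut e k) (cut e (k + 1))) := by
    intro k
    rw [Set.disjoint_left]
    intro z hz hz'
    have : (2 : ℚ) ≤ cut e k := by exact_mod_cast two_le_cut e k
    rw [Set.mem_Iic] at hz
    linarith [hz'.1]
  rcases j with _ | j <;> rcases j' with _ | j'
  · exact absurd rfl h
  · exact key' _
  · exact (key' _).symm
  · have hne : e j ≠ e j' := fun h' => h (congrArg some (e.injective h'))
    rcases lt_or_gt_of_ne hne with hlt | hlt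
    · exact key _ _ hlt
    · exact (key _ _ hlt).symm

theorem disjoint_domain {i i' : I₂ ⊕ I₃ ⊕ Option Im ⊕ Ih ⊕ Ih} (h : i ≠ i') :
    Disjoint (domain e i) (domain e i') := by
  by_cases hg : gadget i = gadget i'
  · -- Distinct generators of the same gadget are the two generators of a handle.
    have key : ∀ c : ℚ, Disjoint (Set.Ioc c (c + 11 / 3) ∪ Set.Ioc (c + 11 / 2) (c + 22 / 3))
        (Set.Ioc (c + 11 / 3) (c + 11 / 2) ∪ Set.Ioc (c + 22 / 3) (c + 11)) := by
      intro c
      rw [Set.disjoint_left]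
      rintro z (⟨h₁, h₂⟩ | ⟨h₁, h₂⟩) (⟨h₃, h₄⟩ | ⟨h₃, h₄⟩) <;> linarith
    rcases i with i | i | (_ | i) | i | i <;> rcases i' with i' | i' | (_ | i') | i' | i' <;>
      simp only [gadget, Option.some.injEq, Sum.inl.injEq, Sum.inr.injEq, reduceCtorEq] at hg <;>
      first
        | exact absurd rfl h
        | subst hg
    all_goals first
      | exact absurd rfl h
      | exact key _
      | exact (key _).symm
  · exact (disjoint_block e hg).mono (domain_subset_block e i) (domain_subset_block e i')

/-! ### Transitivity -/

variable {e} {S : Subgroup PGL(2, ℤ)}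

theorem edgePairing_mem_swap {p q : ℤ} {ε : ℤˣ} (h : edgePairing p q ε ∈ S) :
    edgePairing q p ε ∈ S := by
  rw [← edgePairing_inv]
  exact S.inv_mem h

theorem edgePairing_mem_mul {p q r s p' s' : ℤ} (h₁ : edgePairing p q 1 ∈ S)
    (h₂ : edgePairing r s 1 ∈ S) (hr : r = q - 1) (hp : p' = p + 1) (hs : s' = s - 1) :
    edgePairing p' s' 1 ∈ S := by
  subst hr hp hs
  rw [← edgePairing_mul_edgePairing p q s]
  exact S.mul_mem h₁ h₂

theorem edgePairing_mem_sq {p q p' q' : ℤ} (h : edgePairing p q (-1) ∈ S) (hq : q = p - 1)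
    (hp' : p' = p + 1) (hq' : q' = p - 2) : edgePairing p' q' 1 ∈ S := by
  subst hq hp' hq'
  rw [← edgePairing_neg_one_mul_self]
  exact S.mul_mem h h

/-- Inside the interval of a gadget all integers are reached from `∞`, and the pairing of the two
outermost ones (the boundary word of the gadget) belongs to the subgroup. -/
theorem exists_edgePairing_mem_of_gadget (hS : ∀ i, gen e i ∈ S) (k : ℕ) :
    edgePairing (cut e (k + 1) - 1) (cut e k + 1) 1 ∈ S ∧
      ∀ n, cut e k < n → n < cut e (k + 1) → ∃ q ε, edgePairing n q ε ∈ S := by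
  obtain ⟨j, rfl⟩ := e.surjective k
  rw [cut_succ]
  rcases j with i | i | i | i
  · have h := hS (.inl i)
    simp only [gen] at h
    generalize cut e _ = c at h ⊢
    simp only [width]
    push_cast
    refine ⟨by convert h using 2; ring, fun n h₁ h₂ => ?_⟩
    obtain rfl : n = c + 1 := by omega
    exact ⟨_, _, h⟩
  · have h := hS (.inr (.inl i))
    simp only [gen] at h
    generalize cut e _ = c at h ⊢
    simp only [width]
    push_cast
    refine ⟨by convert h using 2; ring, fun n h₁ h₂ => ?_⟩
    obtain rfl | rfl : n = c + 1 ∨ n = c + 2 := by omega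
    · exact ⟨_, _, edgePairing_mem_swap h⟩
    · exact ⟨_, _, h⟩
  · have h := hS (.inr (.inr (.inl (some i))))
    simp only [gen] at h
    generalize cut e _ = c at h ⊢
    have h' : edgePairing (c + 4) (c + 1) 1 ∈ S :=
      edgePairing_mem_sq h (by ring) (by ring) (by ring)
    simp only [width]
    push_cast
    refine ⟨by convert h' using 2; ring, fun n h₁ h₂ => ?_⟩
    obtain rfl | rfl | rfl | rfl : n = c + 1 ∨ n = c + 2 ∨ n = c + 3 ∨ n = c + 4 := by omega
    · exact ⟨_, _, edgePairing_mem_swap h'⟩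
    · exact ⟨_, _, edgePairing_mem_swap h⟩
    · exact ⟨_, _, h⟩
    · exact ⟨_, _, h'⟩
  · have hX := hS (.inr (.inr (.inr (.inl i))))
    have hY := hS (.inr (.inr (.inr (.inr i))))
    simp only [gen] at hX hY
    generalize cut e _ = c at hX hY ⊢
    -- In terms of the generators `X` and `Y` these are `Y X⁻¹`, `Y⁻¹ X` and their product.
    have h₉ : edgePairing (c + 9) (c + 6) 1 ∈ S :=
      edgePairing_mem_mul hY (edgePairing_mem_swap hX) (by ring) (by ring) (by ring)
    have h₅ : edgePairing (c + 5) (c + 2) 1 ∈ S :=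
      edgePairing_mem_mul (edgePairing_mem_swap hY) hX (by ring) (by ring) (by ring)
    have h' : edgePairing (c + 10) (c + 1) 1 ∈ S :=
      edgePairing_mem_mul h₉ h₅ (by ring) (by ring) (by ring)
    simp only [width]
    push_cast
    refine ⟨by convert h' using 2; ring, fun n h₁ h₂ => ?_⟩
    obtain ⟨m, rfl⟩ : ∃ m, n = c + m := ⟨n - c, by ring⟩
    have hm₁ : 1 ≤ m := by omega
    have hm₂ : m ≤ 10 := by omega
    interval_cases m
    exacts [⟨_, _, edgePairing_mem_swap h'⟩, ⟨_, _, edgePairing_mem_swap h₅⟩,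
      ⟨_, _, edgePairing_mem_swap hX⟩, ⟨_, _, edgePairing_mem_swap hY⟩, ⟨_, _, h₅⟩,
      ⟨_, _, edgePairing_mem_swap h₉⟩, ⟨_, _, hX⟩, ⟨_, _, hY⟩, ⟨_, _, h₉⟩, ⟨_, _, h'⟩]

/-- The product of the boundary words of the first gadgets pairs the right end of the last of
them with a negative integer. -/
theorem edgePairing_cut_mem (hS : ∀ i, gen e i ∈ S) (k : ℕ) :
    edgePairing (cut e k) (-1 - k) 1 ∈ S := by
  induction k with
  | zero =>
    exact edgePairing_mem_sq (hS (.inr (.inr (.inl none)))) (by simp) (by simp [cut]) (by simp)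
  | succ k ih =>
    exact edgePairing_mem_mul (exists_edgePairing_mem_of_gadget hS k).1 ih (by ring) (by ring)
      (by push_cast; ring)

theorem exists_edgePairing_mem (hS : ∀ i, gen e i ∈ S) (n : ℤ) :
    ∃ q ε, edgePairing n q ε ∈ S := by
  have h₀ : edgePairing 1 0 (-1) ∈ S := hS (.inr (.inr (.inl none)))
  have hcut : ∀ k, ∀ n, 2 ≤ n → n ≤ cut e k → ∃ q ε, edgePairing n q ε ∈ S := by
    intro k
    induction k with
    | zero =>
      intro n h₁ h₂
      obtain rfl : n = cut e 0 := le_antisymm h₂ h₁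
      exact ⟨_, _, edgePairing_cut_mem hS 0⟩
    | succ k ih =>
      intro n h₁ h₂
      rcases le_or_gt n (cut e k) with h | h
      · exact ih n h₁ h
      rcases h₂.lt_or_eq with h' | rfl
      · exact (exists_edgePairing_mem_of_gadget hS k).2 n h h'
      · exact ⟨_, _, edgePairing_cut_mem hS (k + 1)⟩
  have hge : ∀ k : ℕ, (k : ℤ) ≤ cut e k := by
    intro k
    induction k with
    | zero => simp [cut]
    | succ k ih =>
      have := cut_lt_cut_succ e k
      push_cast
      omega
  rcases lt_trichotomy n 0 with h | rfl | h
  · obtain ⟨k, rfl⟩ : ∃ k : ℕ, n = -1 - k := ⟨(-1 - n).toNat, by omega⟩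
    exact ⟨_, _, edgePairing_mem_swap (edgePairing_cut_mem hS k)⟩
  · exact ⟨_, _, edgePairing_mem_swap h₀⟩
  · rcases (show 1 ≤ n from h).eq_or_lt with rfl | h
    · exact ⟨_, _, h₀⟩
    · exact hcut n.toNat n h (by have := hge n.toNat; omega)

end Layout

/-! ### The subgroup and its structure -/

section Structure

variable {I₂ I₃ Im Ih : Type} (e : I₂ ⊕ I₃ ⊕ Im ⊕ Ih ≃ ℕ)

/-- The subgroup generated by the elements `gen e i`. -/
noncomputable def genSubgroup : Subgroup PGL(2, ℤ) := Subgroup.closure (Set.range (gen e))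

theorem gen_mem (i : I₂ ⊕ I₃ ⊕ Option Im ⊕ Ih ⊕ Ih) : gen e i ∈ genSubgroup e :=
  Subgroup.subset_closure ⟨i, rfl⟩

/-- The element `gen e i`, as an element of the subgroup that the generators generate. -/
noncomputable def genElem (i : I₂ ⊕ I₃ ⊕ Option Im ⊕ Ih ⊕ Ih) : genSubgroup e :=
  ⟨gen e i, gen_mem e i⟩

theorem surjective_lift_zpowers_genElem :
    Function.Surjective
      (Monoid.CoprodI.lift fun i => (Subgroup.zpowers (genElem e i)).subtype) := by
  rintro ⟨g, hg⟩
  suffices H : g ∈ ((Monoid.CoprodI.lift fun i =>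
      (Subgroup.zpowers (genElem e i)).subtype).range.map (genSubgroup e).subtype) by
    obtain ⟨_, ⟨w, rfl⟩, h⟩ := H
    exact ⟨w, Subtype.ext h⟩
  refine (Subgroup.closure_le _).2 ?_ hg
  rintro _ ⟨i, rfl⟩
  refine ⟨genElem e i, ⟨Monoid.CoprodI.of (i := i)
    (⟨genElem e i, Subgroup.mem_zpowers _⟩ : Subgroup.zpowers (genElem e i)), ?_⟩, rfl⟩
  rw [Monoid.CoprodI.lift_of]
  rfl

/-- The ping-pong argument: it yields both the freeness of the product and the uniqueness part of
the Neumann property. -/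
theorem moebius_lift_infty_ne
    {w : Monoid.CoprodI fun i => Subgroup.zpowers (genElem e i)} (hw : w ≠ 1) :
    moebius (Monoid.CoprodI.lift (fun i => (Subgroup.zpowers (genElem e i)).subtype) w :
      genSubgroup e) OnePoint.infty ≠ OnePoint.infty := by
  let φ : genSubgroup e →* Equiv.Perm (OnePoint ℚ) := moebius.comp (genSubgroup e).subtype
  have hφ : φ.comp (Monoid.CoprodI.lift fun i => (Subgroup.zpowers (genElem e i)).subtype) =
      Monoid.CoprodI.lift fun i => φ.comp (Subgroup.zpowers (genElem e i)).subtype := by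
    ext1 i
    ext1 x
    simp
  have key := lift_smul_ne_of_ping_pong
    (fun i => φ.comp (Subgroup.zpowers (genElem e i)).subtype)
    (fun i => ((↑) '' domain e i : Set (OnePoint ℚ)))
    (fun i j hij => Set.disjoint_image_of_injective OnePoint.coe_injective (disjoint_domain e hij))
    (by
      rintro i ⟨_, k, rfl⟩ hh
      refine playsOn_gen e i k fun h => hh ?_
      exact Subtype.ext (Subtype.ext h))
    (fun i => infty_notMem_image_coe _) hw
  rw [← hφ] at key
  exact key

theorem isFreeProductOf_zpowers_genElem :
    IsFreeProductOf fun i => Subgroup.zpowers (genElem e i) := by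
  refine ⟨(injective_iff_map_eq_one _).2 fun w hw => ?_, surjective_lift_zpowers_genElem e⟩
  by_contra hne
  refine moebius_lift_infty_ne e hne ?_
  rw [hw]
  simp

theorem isNeumann_genSubgroup : IsNeumann (genSubgroup e) := by
  intro r
  obtain ⟨g, hg, hgr⟩ := exists_moebius_infty_eq (exists_edgePairing_mem (gen_mem e)) r
  refine ⟨g, ⟨hg, hgr⟩, ?_⟩
  rintro h ⟨hh, hhr⟩
  obtain ⟨w, hw⟩ := surjective_lift_zpowers_genElem e
    ⟨g⁻¹ * h, (genSubgroup e).mul_mem ((genSubgroup e).inv_mem hg) hh⟩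
  have hw1 : w = 1 := by
    by_contra hne
    refine moebius_lift_infty_ne e hne ?_
    rw [hw, map_mul, Equiv.Perm.mul_apply, hhr, ← hgr, ← Equiv.Perm.mul_apply, ← map_mul]
    simp
  rw [hw1, map_one] at hw
  have := congrArg Subtype.val hw
  exact (inv_mul_eq_one.1 this.symm).symm

theorem not_genSubgroup_le_modularGroup : ¬ genSubgroup e ≤ modularGroup := by
  intro h
  have h₁ : det (edgePairing 1 0 (-1)) = 1 := h (gen_mem e (.inr (.inr (.inl none))))
  rw [det_edgePairing] at h₁
  exact absurd h₁ (by decide)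

theorem isOfFinOrder_genElem_iff (i : I₂ ⊕ I₃ ⊕ Option Im ⊕ Ih ⊕ Ih) :
    IsOfFinOrder (genElem e i) ↔ IsOfFinOrder (gen e i) :=
  Submonoid.isOfFinOrder_coe.symm

theorem orderOf_genElem (i : I₂ ⊕ I₃ ⊕ Option Im ⊕ Ih ⊕ Ih) :
    orderOf (genElem e i) = orderOf (gen e i) :=
  (Subgroup.orderOf_coe _).symm

theorem hasIndependentGenerators_genSubgroup :
    HasIndependentGenerators (genSubgroup e) (ENat.card I₂) (ENat.card I₃)
      (ENat.card (Option Im)) (ENat.card (Ih ⊕ Ih)) := by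
  refine ⟨I₂, I₃, Option Im, Ih ⊕ Ih, fun i => genElem e (.inl i),
    fun i => genElem e (.inr (.inl i)), fun i => genElem e (.inr (.inr (.inl i))),
    fun i => genElem e (.inr (.inr (.inr i))),
    rfl, rfl, rfl, rfl, fun i => ⟨?_, ?_⟩, fun i => ⟨?_, ?_⟩, fun i => ⟨?_, ?_⟩,
    fun i => ⟨?_, ?_⟩, ?_⟩
  · rw [orderOf_genElem]
    exact orderOf_edgePairing_self _
  · exact det_edgePairing _ _ _
  · rw [orderOf_genElem]
    have := orderOf_edgePairing_succ (cut e (e (.inr (.inl i))) + 1)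
    rwa [show ∀ c : ℤ, c + 1 + 1 = c + 2 by intro c; ring] at this
  · exact det_edgePairing _ _ _
  · rw [isOfFinOrder_genElem_iff]
    rcases i with _ | i
    exacts [playsOn_edgePairing_one_zero.2, (playsOn_crosscap _).2]
  · rcases i with _ | i <;> exact det_edgePairing _ _ _
  · rw [isOfFinOrder_genElem_iff]
    rcases i with i | i
    exacts [(playsOn_handle_left _).2, (playsOn_handle_right _).2]
  · rcases i with i | i <;> exact det_edgePairing _ _ _
  · convert isFreeProductOf_zpowers_genElem e using 3 with i
    rcases i with i | i | i | i <;> rfl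

end Structure

theorem HasIndependentGenerators.hasStructure {S : Subgroup PGL(2, ℤ)} {r₂ r₃ rm rp : ℕ∞}
    (h : HasIndependentGenerators S r₂ r₃ rm rp) : HasStructure S r₂ r₃ (rm + rp) := by
  obtain ⟨I₂, I₃, Im, Ip, a, b, c, d, h₂, h₃, hm, hp, ha, hb, hc, hd, hfree⟩ := h
  refine ⟨I₂, I₃, Im ⊕ Ip, fun i => Subgroup.zpowers (a i), fun i => Subgroup.zpowers (b i),
    fun i => Subgroup.zpowers (Sum.elim c d i), h₂, h₃, ?_, fun i => ?_, fun i => ?_,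
    fun i => ⟨inferInstance, ?_⟩, ?_⟩
  · rw [ENat.card_sum, hm, hp]
  · rw [Nat.card_zpowers, (ha i).1]
  · rw [Nat.card_zpowers, (hb i).1]
  · refine Set.infinite_coe_iff.2 (infinite_zpowers.2 ?_)
    rcases i with i | i
    exacts [(hc i).1, (hd i).1]
  · convert hfree using 2 with i
    rcases i with i | i | i | i <;> rfl

theorem exists_countable_enatCard_eq (n : ℕ∞) : ∃ I : Type, Countable I ∧ ENat.card I = n := by
  induction n using ENat.recTopCoe with
  | top => exact ⟨ℕ, inferInstance, by simp⟩
  | coe n => exact ⟨Fin n, inferInstance, by simp⟩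

end NeumannSubgroup

theorem theorem3p3 (r₂ r₃ rm rp : ℕ∞)
    (heven : Even rp)
    (hinf : r₂ + r₃ + (rm + rp) = ⊤)
    (hneg : 1 ≤ rm)
    (hle : 2 * rm ≤ 2 * (r₂ + r₃) + rp) :
    ∃ S : Subgroup PGL(2, ℤ),
      NeumannSubgroup.IsNeumann S ∧
      ¬ S ≤ NeumannSubgroup.modularGroup ∧
      NeumannSubgroup.HasStructure S r₂ r₃ (rm + rp) ∧
      NeumannSubgroup.HasIndependentGenerators S r₂ r₃ rm rp := by
  open NeumannSubgroup in
  -- One orientation-reversing generator is the additional one, the others are crosscaps; the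
  -- orientation-preserving ones come in pairs from handles.
  obtain ⟨h, rfl⟩ := heven
  obtain ⟨m, rfl⟩ := exists_add_of_le hneg
  obtain ⟨I₂, _, rfl⟩ := exists_countable_enatCard_eq r₂
  obtain ⟨I₃, _, rfl⟩ := exists_countable_enatCard_eq r₃
  obtain ⟨Im, _, rfl⟩ := exists_countable_enatCard_eq m
  obtain ⟨Ih, _, rfl⟩ := exists_countable_enatCard_eq h
  have hinfinite : Infinite (I₂ ⊕ I₃ ⊕ Im ⊕ Ih) := by
    rw [← ENat.card_eq_top]
    simp only [ENat.card_sum, ENat.add_eq_top, ENat.one_ne_top] at hinf ⊢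
    tauto
  obtain ⟨e⟩ : Nonempty (I₂ ⊕ I₃ ⊕ Im ⊕ Ih ≃ ℕ) := by
    obtain ⟨_⟩ := nonempty_denumerable (I₂ ⊕ I₃ ⊕ Im ⊕ Ih)
    exact ⟨Denumerable.eqv _⟩
  have hgen := hasIndependentGenerators_genSubgroup e
  rw [ENat.card_sum, show ENat.card (Option Im) = 1 + ENat.card Im by
    rw [ENat.card_congr (Equiv.optionEquivSumPUnit.{0} Im), ENat.card_sum, add_comm]; simp] at hgen
  exact ⟨genSubgroup e, isNeumann_genSubgroup e, not_genSubgroup_le_modularGroup e,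
    hgen.hasStructure, hgen⟩
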